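/- Theorem 4.1. Let $A$ be a finite alphabet and let $\zeta$ be a substitution on $A$, that is, a map assigning to every letter of $A$ a nonempty finite word over $A$, extended to words by concatenation. Suppose that $\zeta$ is primitive: there is $n\ge 1$ such that for all $a,b\in A$ the letter $b$ occurs in $\zeta^n(a)$. Let $X_\zeta\subset A^{\mathbb Z}$ be the substitution dynamical system of $\zeta$, that is, the subshift of all $x\in A^{\mathbb Z}$ such that every finite block of consecutive letters of $x$ is a block of consecutive letters of $\zeta^n(a)$ for some $n\ge 0$ and some $a\in A$. Then $X_\zeta$ is $\lambda$-synchronizing. Here, for a subshift $X\subset A^{\mathbb Z}$ (a closed shift-invariant set), $\mathcal L(X)$ denotes the set of finite words that appear in points of $X$, $\mathcal L_l(X)$ the set of those of length $l$, $\Gamma^+(w)=\{c\in\mathcal L(X): wc\in\mathcal L(X)\}$, $\Gamma^-_l(v)=\{b\in\mathcal L_l(X): bv\in\mathcal L(X)\}$ and $$\omega^-_l(v)=\bigcap_{c\in\Gamma^+(v)}\{b\in\mathcal L_l(X): bvc\in\mathcal L(X)\}.$$ A word $v\in\mathcal L(X)$ is $l$-synchronizing if $\Gamma^-_l(v)\subset\omega^-_l(v)$,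 and $X$ is $\lambda$-synchronizing if for every $w\in\mathcal L(X)$ and every $k\in\mathbb N$ there is a $k$-synchronizing word $v\in\Gamma^+(w)$. -/

import Mathlib

open SymbolicDynamics.FullShift

namespace LambdaSync

/-! ### Words of a two-sided subshift

A word over the alphabet `A` is a `List A`; a subshift is Mathlib's `Subshift A ℤ`, a closed
shift-invariant subset of `ℤ → A`. -/

/-- The word `x i, x (i + 1), …, x (i + n - 1)`. -/
def wordAt {A : Type*} (x : ℤ → A) (i : ℤ) (n : ℕ) : List A :=
  List.ofFn fun j : Fin n => x (i + (j : ℕ))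

section Subshifts

variable {A : Type*} [TopologicalSpace A]

/-- The language `L(X)`: the words that appear somewhere in a point of `X`. -/
def language (X : Subshift A ℤ) : Set (List A) :=
  {w | ∃ x ∈ X.carrier, ∃ i : ℤ, wordAt x i w.length = w}

/-- `L_n(X)`: the admissible words of length `n`. -/
def languageOfLength (X : Subshift A ℤ) (n : ℕ) : Set (List A) :=
  {w | w ∈ language X ∧ w.length = n}

/-- `Γ⁺(a) = {c ∈ L(X) | ac ∈ L(X)}`. -/
def followers (X : Subshift A ℤ) (a : List A) : Set (List A) :=
  {c | c ∈ language X ∧ a ++ c ∈ language X}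

/-- `Γ⁻_n(a) = {b ∈ L_n(X) | ba ∈ L(X)}`. -/
def predecessors (X : Subshift A ℤ) (n : ℕ) (a : List A) : Set (List A) :=
  {b | b ∈ languageOfLength X n ∧ b ++ a ∈ language X}

/-- `ω⁻_n(a) = ⋂_{c ∈ Γ⁺(a)} {b ∈ L_n(X) | bac ∈ L(X)}`. -/
def omegaMinus (X : Subshift A ℤ) (n : ℕ) (a : List A) : Set (List A) :=
  ⋂ c ∈ followers X a, {b | b ∈ languageOfLength X n ∧ b ++ a ++ c ∈ language X}

/-- `S_l(X)`: the `l`-synchronizing words of `X`, that is the admissible words `v` with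
`Γ⁻_l(v) ⊆ ω⁻_l(v)`. -/
def synchronizingWords (X : Subshift A ℤ) (l : ℕ) : Set (List A) :=
  {v | v ∈ language X ∧ predecessors X l v ⊆ omegaMinus X l v}

/-- `X` is `λ`-synchronizing if for all `w ∈ L(X)` and `k` the set `S_k(X) ∩ Γ⁺(w)` is
nonempty. -/
def IsLambdaSynchronizing (X : Subshift A ℤ) : Prop :=
  ∀ w ∈ language X, ∀ k : ℕ, (synchronizingWords X k ∩ followers X w).Nonempty

end Subshifts

/-! ### Substitutions -/

/-- A substitution on `A` assigns to every letter a nonempty word. -/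
structure Substitution (A : Type*) where
  /-- The image of a letter. -/
  image : A → List A
  image_ne_nil : ∀ a, image a ≠ []

namespace Substitution

variable {A : Type*}

/-- The extension of a substitution to words by concatenation. -/
def onWords (ζ : Substitution A) (w : List A) : List A :=
  w.flatMap ζ.image

/-- The word `ζⁿ(a)`. -/
def iter (ζ : Substitution A) (n : ℕ) (a : A) : List A :=
  ζ.onWords^[n] [a]

/-- `ζ` is primitive if for some `n ≥ 1` every letter occurs in `ζⁿ(a)`, for every letter `a`. -/
def IsPrimitive (ζ : Substitution A) : Prop :=
  ∃ n : ℕ, 1 ≤ n ∧ ∀ a b : A, b ∈ ζ.iter n a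

/-- The two-sided sequences all of whose finite subwords are subwords of words `ζⁿ(a)`. -/
def points (ζ : Substitution A) : Set (ℤ → A) :=
  {x | ∀ (i : ℤ) (m : ℕ), ∃ (n : ℕ) (a : A), wordAt x i m <:+: ζ.iter n a}

/-- The substitution dynamical system of `ζ`, as a subshift (with the restriction of the shift). -/
def subshift [TopologicalSpace A] [DiscreteTopology A] (ζ : Substitution A) : Subshift A ℤ where
  carrier := ζ.points
  isClosed := by
    have h : ζ.points = ⋂ (i : ℤ) (m : ℕ),
        (fun x : ℤ → A => fun j : Fin m => x (i + (j : ℕ))) ⁻¹'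
          {f | ∃ (n : ℕ) (a : A), List.ofFn f <:+: ζ.iter n a} := by
      ext x
      simp [points, wordAt]
    rw [h]
    refine isClosed_iInter fun i => isClosed_iInter fun m => ?_
    exact (isClosed_discrete _).preimage (by fun_prop)
  mapsTo := by
    intro g x hx i m
    obtain ⟨n, a, h⟩ := hx (g + i) m
    refine ⟨n, a, ?_⟩
    simpa [wordAt, shift, add_assoc] using h

end Substitution

end LambdaSync

/-! Suppose no follower of `w` is `k`-synchronizing. A word with a unique predecessor of length `k`
is `k`-synchronizing, so each follower of `w` has two of them, and p(n + k) ≥ p(n) + f(n), where p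
is the complexity and f(n) counts the followers of `w` of length n. If `w` occurs in every word of
length R, then p(n) ≤ (R + 1) f(n + R). Together these make p grow exponentially
(`exponential_le_complexity`), whereas a primitive substitution has p(n) = O(n) for infinitely many
n (`IsPrimitive.exists_complexity_le`). -/

namespace LambdaSync

/-! ### Combinatorics of words and products of blocks -/

section Words

variable {A : Type*}

@[simp]
theorem length_wordAt (x : ℤ → A) (i : ℤ) (n : ℕ) : (wordAt x i n).length = n := by
  simp [wordAt]

theorem wordAt_add (x : ℤ → A) (i : ℤ) (m n : ℕ) :
    wordAt x i (m + n) = wordAt x i m ++ wordAt x (i + m) n := by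
  simp [wordAt, List.ofFn_add, add_assoc]

/-- A factor of a product of two words lies in one of them or splits accordingly. -/
theorem infix_append_cases {u v w : List A} (h : u <:+: v ++ w) :
    u <:+: v ∨ u <:+: w ∨ ∃ s t, u = s ++ t ∧ s <:+ v ∧ t <+: w := by
  obtain ⟨p, q, h⟩ := h
  rw [List.append_assoc] at h
  rcases List.append_eq_append_iff.1 h with ⟨c, hv, hu⟩ | ⟨c, hp, hw⟩
  · rcases List.append_eq_append_iff.1 hu with ⟨d, hd, hw⟩ | ⟨d, hd, hw⟩
    · exact Or.inl ⟨p, d, by simp [hv, hd]⟩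
    · exact Or.inr <| Or.inr ⟨c, d, hd, ⟨p, hv.symm⟩, ⟨q, hw.symm⟩⟩
  · exact Or.inr <| Or.inl ⟨c, q, by simp [hw]⟩

/-- A word shorter than every block, occurring in a product of blocks, occurs in a product of two
blocks. -/
theorem exists_infix_append_of_infix_flatMap {f : A → List A} {u : List A}
    (hu : ∀ a, u.length ≤ (f a).length) :
    ∀ {l : List A}, l ≠ [] → u <:+: l.flatMap f → ∃ a b, u <:+: f a ++ f b
  | [], hl, _ => absurd rfl hl
  | [a], _, h => ⟨a, a, List.infix_append_of_infix_left (by simpa using h)⟩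
  | a :: b :: l, _, h => by
    rw [List.flatMap_cons] at h
    rcases infix_append_cases h with h | h | ⟨s, t, rfl, hs, ht⟩
    · exact ⟨a, a, List.infix_append_of_infix_left h⟩
    · exact exists_infix_append_of_infix_flatMap hu (List.cons_ne_nil b l) h
    · have htb : t <+: f b := by
        rw [List.flatMap_cons] at ht
        refine List.prefix_of_prefix_length_le ht (List.prefix_append _ _) ?_
        have := hu b
        simp only [List.length_append] at this
        lia
      obtain ⟨p, hp⟩ := hs
      obtain ⟨q, hq⟩ := htb
      exact ⟨a, b, p, q, by simp [← hp, ← hq]⟩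

/-- A word more than twice as long as every block, occurring in a product of blocks, contains a
block. -/
theorem exists_infix_of_infix_flatMap {f : A → List A} {M : ℕ} (hM : ∀ a, (f a).length ≤ M)
    {u : List A} (hu : 2 * M < u.length) :
    ∀ {l : List A}, u <:+: l.flatMap f → ∃ a, f a <:+: u
  | [], h => by
    have := h.length_le
    simp at this
    simp [this] at hu
  | a :: l, h => by
    rw [List.flatMap_cons] at h
    rcases infix_append_cases h with h | h | ⟨s, t, rfl, hs, ht⟩
    · have := h.length_le.trans (hM a)
      lia
    · exact exists_infix_of_infix_flatMap hM hu h
    · have hsl := hs.length_le.trans (hM a)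
      rw [List.length_append] at hu
      cases l with
      | nil =>
        have := ht.length_le
        simp at this
        simp [this] at hu
        lia
      | cons b l =>
        rw [List.flatMap_cons] at ht
        -- Since `s` has at most `M` letters, `t` has more than `M`, so it covers the block `f b`.
        have hb : f b <+: t := List.prefix_of_prefix_length_le (List.prefix_append _ _) ht
          ((hM b).trans (by lia))
        exact ⟨b, hb.isInfix.trans (List.suffix_append s t).isInfix⟩

/-- The number of factors of length `n` of a family of words of bounded length. -/
theorem ncard_factors_le {ι : Type*} [Finite ι] (g : ι → List A) (N n : ℕ)
    (hN : ∀ i, (g i).length ≤ N) (S : Set (List A))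
    (hS : ∀ u ∈ S, u.length = n ∧ ∃ i, u <:+: g i) : S.ncard ≤ Nat.card ι * (N + 1) := by
  have hsub : S ⊆ Set.range fun q : ι × Fin (N + 1) => ((g q.1).drop q.2).take n := by
    intro u hu
    obtain ⟨hn, i, s, t, h⟩ := hS u hu
    have hs : s.length < N + 1 := by
      have := hN i
      rw [← h] at this
      simp only [List.length_append] at this
      lia
    exact ⟨(i, ⟨s.length, hs⟩), by simp [← h, ← hn]⟩
  calc S.ncard ≤ (Set.range fun q : ι × Fin (N + 1) => ((g q.1).drop q.2).take n).ncard :=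
        Set.ncard_le_ncard hsub (Set.finite_range _)
    _ ≤ Nat.card (ι × Fin (N + 1)) := by
        rw [← Nat.card_coe_set_eq]
        exact Finite.card_range_le _
    _ = Nat.card ι * (N + 1) := by simp [Nat.card_prod]

end Words

/-! ### Languages of subshifts -/

section Language

variable {A : Type*} [TopologicalSpace A] {X : Subshift A ℤ}

theorem wordAt_mem_language {x : ℤ → A} (hx : x ∈ X.carrier) (i : ℤ) (n : ℕ) :
    wordAt x i n ∈ language X :=
  ⟨x, hx, i, by simp⟩

theorem mem_language_of_infix {u v : List A} (h : u <:+: v) (hv : v ∈ language X) :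
    u ∈ language X := by
  obtain ⟨s, t, rfl⟩ := h
  obtain ⟨x, hx, i, hi⟩ := hv
  rw [List.length_append, List.length_append, wordAt_add, wordAt_add] at hi
  have h₁ := (List.append_inj hi (by simp)).1
  have h₂ := (List.append_inj h₁ (by simp)).2
  exact h₂ ▸ wordAt_mem_language hx _ _

theorem exists_left_extension {v : List A} (hv : v ∈ language X) (n : ℕ) :
    ∃ u, u.length = n ∧ u ++ v ∈ language X := by
  obtain ⟨x, hx, i, hi⟩ := hv
  refine ⟨wordAt x (i - n) n, by simp, ?_⟩
  have := wordAt_add x (i - n) n v.length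
  rw [sub_add_cancel, hi] at this
  exact this ▸ wordAt_mem_language hx _ _

theorem exists_right_extension {v : List A} (hv : v ∈ language X) (n : ℕ) :
    ∃ u, u.length = n ∧ v ++ u ∈ language X := by
  obtain ⟨x, hx, i, hi⟩ := hv
  refine ⟨wordAt x (i + v.length) n, by simp, ?_⟩
  have := wordAt_add x i v.length n
  rw [hi] at this
  exact this ▸ wordAt_mem_language hx _ _

/-- A word with at most one predecessor of length `k` is `k`-synchronizing. -/
theorem mem_synchronizingWords_of_subsingleton {v : List A} {k : ℕ} (hv : v ∈ language X)
    (h : (predecessors X k v).Subsingleton) : v ∈ synchronizingWords X k := by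
  refine ⟨hv, fun b hb => Set.mem_iInter₂.2 fun c hc => ⟨hb.1, ?_⟩⟩
  -- Some word `b'` precedes `v ++ c`; it also precedes `v`, so uniqueness gives `b' = b`.
  obtain ⟨b', hb', hL⟩ := exists_left_extension hc.2 k
  have hb'' : b' ∈ predecessors X k v :=
    ⟨⟨mem_language_of_infix (List.prefix_append _ _).isInfix hL, hb'⟩,
      mem_language_of_infix ⟨[], c, by simp⟩ hL⟩
  rw [h hb hb'', List.append_assoc]
  exact hL

/-! ### Complexity and follower counts -/

variable [Finite A]

theorem finite_languageOfLength (X : Subshift A ℤ) (n : ℕ) : (languageOfLength X n).Finite :=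
  (List.finite_length_eq A n).subset fun _ h => h.2

/-- The complexity function of `X`. -/
noncomputable def complexity (X : Subshift A ℤ) (n : ℕ) : ℕ :=
  (languageOfLength X n).ncard

/-- The number of words of length `n` that may follow `w`. -/
noncomputable def followerCount (X : Subshift A ℤ) (w : List A) (n : ℕ) : ℕ :=
  {v | v.length = n ∧ w ++ v ∈ language X}.ncard

theorem complexity_mono (X : Subshift A ℤ) : Monotone (complexity X) := by
  intro m n hmn
  have hsub : languageOfLength X m ⊆ List.take m '' languageOfLength X n := by
    rintro v ⟨hv, rfl⟩
    obtain ⟨u, hu, huv⟩ := exists_right_extension hv (n - v.length)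
    exact ⟨v ++ u, ⟨huv, by simp [hu, hmn]⟩, by simp⟩
  exact (Set.ncard_le_ncard hsub ((finite_languageOfLength X n).image _)).trans
    (Set.ncard_image_le (finite_languageOfLength X n))

theorem complexity_pos {w : List A} (hw : w ∈ language X) (n : ℕ) : 0 < complexity X n := by
  obtain ⟨x, hx, -⟩ := hw
  exact (Set.ncard_pos (finite_languageOfLength X n)).2
    ⟨wordAt x 0 n, wordAt_mem_language hx 0 n, by simp⟩

/-- If no follower of `w` is `k`-synchronizing, then each of them has two predecessors of length
`k`. -/
theorem complexity_add_followerCount_le {w : List A} {k : ℕ}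
    (h : ¬(synchronizingWords X k ∩ followers X w).Nonempty) (n : ℕ) :
    complexity X n + followerCount X w n ≤ complexity X (n + k) := by
  set F : Set (List A) := {v | v.length = n ∧ w ++ v ∈ language X}
  have hF : ∀ v ∈ F, v ∈ language X := fun v hv =>
    mem_language_of_infix (List.suffix_append w v).isInfix hv.2
  have hFL : F ⊆ languageOfLength X n := fun v hv => ⟨hF v hv, hv.1⟩
  have hpred : ∀ v ∈ languageOfLength X n, ∃ u, u.length = k ∧ u ++ v ∈ language X :=
    fun v hv => exists_left_extension hv.1 k
  choose! g hgl hg using hpred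
  -- If `g v` were the only predecessor, `v` would be synchronizing.
  have hpred' : ∀ v ∈ F, ∃ u, u.length = k ∧ u ++ v ∈ language X ∧ u ≠ g v := by
    intro v hv
    by_contra! hne
    refine h ⟨v, mem_synchronizingWords_of_subsingleton (hF v hv) ?_, hF v hv, hv.2⟩
    intro b hb b' hb'
    rw [hne b hb.1.2 hb.2, hne b' hb'.1.2 hb'.2]
  choose! g' hgl' hg' hne using hpred'
  have hinj : Set.InjOn (fun v => g v ++ v) (languageOfLength X n) := by
    intro v hv v' hv' e
    exact (List.append_inj e (by rw [hgl v hv, hgl v' hv'])).2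
  have hinj' : Set.InjOn (fun v => g' v ++ v) F := by
    intro v hv v' hv' e
    exact (List.append_inj e (by rw [hgl' v hv, hgl' v' hv'])).2
  have hdisj : Disjoint ((fun v => g v ++ v) '' languageOfLength X n)
      ((fun v => g' v ++ v) '' F) := by
    rw [Set.disjoint_left]
    rintro _ ⟨v, hv, rfl⟩ ⟨v', hv', e⟩
    obtain ⟨e₁, rfl⟩ := List.append_inj e (by rw [hgl v hv, hgl' v' hv'])
    exact hne _ hv' e₁
  have hfin := finite_languageOfLength X n
  have hsub : (fun v => g v ++ v) '' languageOfLength X n ∪ (fun v => g' v ++ v) '' F ⊆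
      languageOfLength X (n + k) := by
    rintro _ (⟨v, hv, rfl⟩ | ⟨v, hv, rfl⟩)
    · exact ⟨hg v hv, by simp [hgl v hv, hv.2, add_comm]⟩
    · exact ⟨hg' v hv, by simp [hgl' v hv, hv.1, add_comm]⟩
  have hcard := Set.ncard_le_ncard hsub (finite_languageOfLength X (n + k))
  rwa [Set.ncard_union_eq hdisj (hfin.image _) ((hfin.subset hFL).image _),
    hinj.ncard_image, hinj'.ncard_image] at hcard

/-- If `w` occurs in every word of length `R`, then every word of length `n` is a factor of a
follower of `w` of length `n + R`, at a position at most `R`. -/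
theorem complexity_le_mul_followerCount {w : List A} {R : ℕ}
    (hR : ∀ u ∈ languageOfLength X R, w <:+: u) (n : ℕ) :
    complexity X n ≤ (R + 1) * followerCount X w (n + R) := by
  set F : Set (List A) := {v | v.length = n + R ∧ w ++ v ∈ language X}
  have hFfin : F.Finite := (List.finite_length_eq A (n + R)).subset fun _ h => h.1
  set S : Set (List A × ℕ) := F ×ˢ Set.Iic R
  have hSfin : S.Finite := hFfin.prod (Set.finite_Iic R)
  have hsub : languageOfLength X n ⊆ (fun q : List A × ℕ => (q.1.drop q.2).take n) '' S := by
    rintro v ⟨hv, rfl⟩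
    obtain ⟨u, hu, huv⟩ := exists_left_extension hv R
    obtain ⟨s, t, rfl⟩ := hR u ⟨mem_language_of_infix (List.prefix_append _ _).isInfix huv, hu⟩
    simp only [List.length_append] at hu
    have htv : w ++ (t ++ v) ∈ language X :=
      mem_language_of_infix ⟨s, [], by simp⟩ huv
    obtain ⟨e, he, hL⟩ := exists_right_extension htv (R - t.length)
    -- The tail `t` after an occurrence of `w` has at most `R` letters; `e` pads the follower to the
    -- fixed length, and `v` is read off at offset `t.length`.
    refine ⟨(t ++ v ++ e, t.length), ⟨⟨?_, by simpa using hL⟩, ?_⟩, by simp⟩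
    · simp only [List.length_append]
      lia
    · simp only [Set.mem_Iic]
      lia
  calc complexity X n ≤ ((fun q : List A × ℕ => (q.1.drop q.2).take n) '' S).ncard :=
        Set.ncard_le_ncard hsub (hSfin.image _)
    _ ≤ S.ncard := Set.ncard_image_le hSfin
    _ = (R + 1) * followerCount X w (n + R) := by
        rw [Set.ncard_prod, mul_comm, Set.ncard_eq_toFinset_card' (Set.Iic R)]
        simp [followerCount, F]

/-- In a uniformly recurrent subshift without `k`-synchronizing followers of `w` the complexity
grows exponentially. -/
theorem exponential_le_complexity {w : List A} {k R : ℕ} (hw : w ∈ language X)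
    (hR : ∀ u ∈ languageOfLength X R, w <:+: u)
    (h : ¬(synchronizingWords X k ∩ followers X w).Nonempty) (j : ℕ) :
    (R + 2) ^ j ≤ (R + 1) ^ j * complexity X (j * (R + k)) := by
  induction j with
  | zero => simpa using Nat.succ_le_of_lt (complexity_pos hw 0)
  | succ j ih =>
    set n := j * (R + k)
    have h₁ := complexity_add_followerCount_le h (n + R)
    have h₂ := complexity_le_mul_followerCount hR n
    have h₃ := complexity_mono X (Nat.le_add_right n R)
    -- Multiply `h₁` by R + 1, then use `h₂` for the follower term and `h₃` for the other.
    have h₄ : (R + 2) * complexity X n ≤ (R + 1) * complexity X (n + R + k) := by nlinarith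
    have h₅ : (j + 1) * (R + k) = n + R + k := by simp only [n]; ring
    calc (R + 2) ^ (j + 1) = (R + 2) * (R + 2) ^ j := by ring
      _ ≤ (R + 2) * ((R + 1) ^ j * complexity X n) := Nat.mul_le_mul_left _ ih
      _ = (R + 1) ^ j * ((R + 2) * complexity X n) := by ring
      _ ≤ (R + 1) ^ j * ((R + 1) * complexity X (n + R + k)) := Nat.mul_le_mul_left _ h₄
      _ = (R + 1) ^ (j + 1) * complexity X ((j + 1) * (R + k)) := by rw [h₅]; ring

/-- A uniformly recurrent subshift whose complexity is linearly bounded along a sequence is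
`λ`-synchronizing. -/
theorem isLambdaSynchronizing_of_complexity_le
    (hrec : ∀ w ∈ language X, ∃ R, ∀ u ∈ languageOfLength X R, w <:+: u)
    (C : ℕ) (hC : X.carrier.Nonempty → ∀ N, ∃ n, N ≤ n ∧ complexity X n ≤ C * (n + 1)) :
    IsLambdaSynchronizing X := by
  intro w hw k
  by_contra h
  obtain ⟨R₀, hR₀⟩ := hrec w hw
  -- Positivity of `R` keeps the step `D` positive even when `k = 0`.
  obtain ⟨R, hRpos, hR⟩ : ∃ R, 0 < R ∧ ∀ u ∈ languageOfLength X R, w <:+: u := by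
    refine ⟨R₀ + 1, Nat.succ_pos _, fun u hu => ?_⟩
    exact (hR₀ (u.take R₀) ⟨mem_language_of_infix (List.take_prefix _ _).isInfix hu.1,
      by simp [hu.2]⟩).trans (List.take_prefix _ _).isInfix
  set D := R + k
  have hD : 0 < D := by lia
  set r : ℝ := (R + 2) / (R + 1)
  have hr : 1 < r := by
    rw [lt_div_iff₀ (by positivity)]
    linarith
  have hlow (j : ℕ) : r ^ j ≤ complexity X (j * D) := by
    rw [div_pow, div_le_iff₀ (by positivity), mul_comm]
    exact_mod_cast exponential_le_complexity hw hR h j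
  have hlim : Filter.Tendsto (fun j : ℕ => (j : ℝ) / r ^ j) Filter.atTop (nhds 0) := by
    simpa using tendsto_pow_const_div_const_pow_of_one_lt 1 hr
  -- Chosen so that j / r ^ j below this value contradicts the bound r ^ j ≤ 2CDj of `h₄`; the
  -- summand 1 covers `C = 0`.
  have hε : (0 : ℝ) < 1 / (2 * (C * D + 1)) := by positivity
  obtain ⟨J, hJ⟩ := Filter.eventually_atTop.1 (hlim.eventually_lt_const hε)
  obtain ⟨x, hx, -⟩ := hw
  obtain ⟨n, hn, hnC⟩ := hC ⟨x, hx⟩ ((J + 1) * D)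
  have hj : J + 1 ≤ n / D := (Nat.le_div_iff_mul_le hD).2 hn
  set j := n / D
  have h₁ : j * D ≤ n := Nat.div_mul_le_self n D
  have h₂ : n + 1 ≤ (j + 1) * D := by
    have := Nat.lt_div_mul_add hD (a := n)
    lia
  have h₃ : complexity X (j * D) ≤ C * D * (2 * j) := by
    calc complexity X (j * D) ≤ complexity X n := complexity_mono X h₁
      _ ≤ C * (n + 1) := hnC
      _ ≤ C * ((j + 1) * D) := Nat.mul_le_mul_left _ h₂
      _ = C * D * (j + 1) := by ring
      _ ≤ C * D * (2 * j) := Nat.mul_le_mul_left _ (by lia)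
  have h₄ : r ^ j ≤ C * D * (2 * j) := (hlow j).trans (by exact_mod_cast h₃)
  have h₅ := hJ j (by lia)
  rw [div_lt_div_iff₀ (by positivity) (by positivity)] at h₅
  have h₆ : (1 : ℝ) ≤ j := by exact_mod_cast (by lia : 1 ≤ j)
  nlinarith

end Language

/-! ### Primitive substitutions: recurrence and linear complexity -/

namespace Substitution

variable {A : Type*} (ζ : Substitution A)

theorem iterate_onWords (m : ℕ) (w : List A) : ζ.onWords^[m] w = w.flatMap (ζ.iter m) := by
  induction m with
  | zero =>
    have : ζ.iter 0 = fun a => [a] := rfl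
    simp [this]
  | succ m ih =>
    have : ζ.iter (m + 1) = fun a => (ζ.iter m a).flatMap ζ.image := by
      funext a
      simp [iter, Function.iterate_succ_apply', onWords]
    rw [Function.iterate_succ_apply', ih, this, onWords, List.flatMap_assoc]

theorem iter_add (m n : ℕ) (a : A) : ζ.iter (m + n) a = (ζ.iter n a).flatMap (ζ.iter m) := by
  rw [← iterate_onWords, iter, Function.iterate_add_apply]
  rfl

theorem iter_ne_nil (n : ℕ) (a : A) : ζ.iter n a ≠ [] := by
  induction n with
  | zero => simp [iter]
  | succ n ih =>
    obtain ⟨b, l, h⟩ := List.exists_cons_of_ne_nil ih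
    rw [add_comm, iter_add, h]
    simp [iter, onWords, ζ.image_ne_nil]

theorem iter_infix_iter_add {m n : ℕ} {a b : A} (h : b ∈ ζ.iter n a) :
    ζ.iter m b <:+: ζ.iter (m + n) a := by
  obtain ⟨s, t, hst⟩ := List.append_of_mem h
  rw [iter_add, hst]
  exact ⟨s.flatMap (ζ.iter m), t.flatMap (ζ.iter m), by simp⟩

theorem exists_length_iter_le [Finite A] (m : ℕ) :
    ∃ M, ∀ a, (ζ.iter m a).length ≤ M := by
  obtain ⟨M, hM⟩ := (Set.finite_range fun a => (ζ.iter m a).length).bddAbove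
  exact ⟨M, fun a => hM ⟨a, rfl⟩⟩

variable {ζ} [TopologicalSpace A] [DiscreteTopology A]

theorem exists_infix_iter_of_mem_language {w : List A} (hw : w ∈ language ζ.subshift) :
    ∃ n a, w <:+: ζ.iter n a := by
  obtain ⟨x, hx, i, h⟩ := hw
  exact h ▸ hx i w.length

/-- The words of the system of a primitive substitution occur in products of blocks `ζᵐ(a)`. -/
theorem IsPrimitive.exists_infix_flatMap (hζ : ζ.IsPrimitive) (m : ℕ) {w : List A}
    (hw : w ∈ language ζ.subshift) : ∃ l, l ≠ [] ∧ w <:+: l.flatMap (ζ.iter m) := by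
  obtain ⟨N, hN, hprim⟩ := hζ
  obtain ⟨n, a, h⟩ := exists_infix_iter_of_mem_language hw
  -- Primitivity passes to all positive multiples of `N`, so the exponent can be raised past `m`.
  have hmul (j : ℕ) : ∀ b, a ∈ ζ.iter (N * j) b ∨ j = 0 := by
    induction j with
    | zero => simp
    | succ j ih =>
      intro b
      left
      rw [Nat.mul_succ, add_comm, iter_add, List.mem_flatMap]
      obtain ⟨c, hc⟩ := List.exists_mem_of_ne_nil _ (ζ.iter_ne_nil (N * j) b)
      exact ⟨c, hc, hprim c a⟩
  have ha := (hmul (m + 1) a).resolve_right (Nat.succ_ne_zero m)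
  have hle : m ≤ n + N * (m + 1) := by nlinarith
  refine ⟨ζ.iter (n + N * (m + 1) - m) a, ζ.iter_ne_nil _ _, ?_⟩
  rw [← iter_add, Nat.add_sub_cancel' hle]
  exact h.trans (ζ.iter_infix_iter_add ha)

variable [Finite A]

/-- If `w` lies in ζⁿ(a), then it lies in every block ζⁿ⁺ᴺ(b), and a word longer than two such
blocks contains a whole one. -/
theorem IsPrimitive.uniformly_recurrent (hζ : ζ.IsPrimitive) {w : List A}
    (hw : w ∈ language ζ.subshift) :
    ∃ R, ∀ u ∈ languageOfLength ζ.subshift R, w <:+: u := by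
  obtain ⟨N, hN, hprim⟩ := id hζ
  obtain ⟨n, a, h⟩ := exists_infix_iter_of_mem_language hw
  obtain ⟨M, hM⟩ := ζ.exists_length_iter_le (n + N)
  refine ⟨2 * M + 1, fun u hu => ?_⟩
  obtain ⟨l, -, hl⟩ := hζ.exists_infix_flatMap (n + N) hu.1
  obtain ⟨b, hb⟩ := exists_infix_of_infix_flatMap hM (by rw [hu.2]; lia) hl
  exact (h.trans (ζ.iter_infix_iter_add (hprim b a))).trans hb

/-- The complexity of the system of a primitive substitution is linearly bounded along the sequence
of the smallest lengths of the words `ζᵐ(a)`. -/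
theorem IsPrimitive.exists_complexity_le (hζ : ζ.IsPrimitive) :
    ∃ C, ζ.subshift.carrier.Nonempty → ∀ N, ∃ n, N ≤ n ∧
      complexity ζ.subshift n ≤ C * (n + 1) := by
  obtain ⟨p, hp, hprim⟩ := id hζ
  obtain ⟨L, hL⟩ := ζ.exists_length_iter_le p
  -- A word of length n lies in a product of two blocks of length at most Ln: pairs of letters times
  -- 2Ln + 1 ≤ (2L + 1)(n + 1) starting positions.
  refine ⟨Nat.card (A × A) * (2 * L + 1), ?_⟩
  rintro ⟨x, hx⟩ N
  have : Nonempty A := ⟨x 0⟩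
  -- A point of the system forces long blocks. Without one they may stay bounded, as for ζ(a) = a on
  -- one letter.
  obtain ⟨m, a, hma⟩ := exists_infix_iter_of_mem_language (wordAt_mem_language hx 0 N)
  have hN : N ≤ (ζ.iter m a).length := by simpa using hma.length_le
  obtain ⟨c, hc⟩ := Finite.exists_max fun b => (ζ.iter m b).length
  obtain ⟨d, hd⟩ := Finite.exists_min fun b => (ζ.iter (m + p) b).length
  -- The longest block of level `m` sits inside the shortest of level `m + p`, so block lengths at
  -- level `m + p` are comparable up to the factor `L`.
  have hmin : (ζ.iter m c).length ≤ (ζ.iter (m + p) d).length :=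
    (ζ.iter_infix_iter_add (hprim d c)).length_le
  have hmax (b : A) : (ζ.iter (m + p) b).length ≤ L * (ζ.iter (m + p) d).length := by
    rw [iter_add, List.length_flatMap]
    refine (List.sum_le_card_nsmul _ (ζ.iter m c).length ?_).trans ?_
    · simp only [List.mem_map]
      rintro _ ⟨e, -, rfl⟩
      exact hc e
    · rw [List.length_map, smul_eq_mul]
      exact Nat.mul_le_mul (hL b) hmin
  set n := (ζ.iter (m + p) d).length
  refine ⟨n, hN.trans ((hc a).trans hmin), ?_⟩
  have hcount := ncard_factors_le (fun q : A × A => ζ.iter (m + p) q.1 ++ ζ.iter (m + p) q.2)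
    (2 * (L * n)) n (fun q => by
      rw [List.length_append]
      linarith [hmax q.1, hmax q.2]) (languageOfLength ζ.subshift n) (by
      rintro u ⟨hu, hun⟩
      obtain ⟨l, hl, hul⟩ := hζ.exists_infix_flatMap (m + p) hu
      obtain ⟨b, b', h⟩ := exists_infix_append_of_infix_flatMap
        (fun a => hun.trans_le (hd a)) hl hul
      exact ⟨hun, (b, b'), h⟩)
  refine hcount.trans ?_
  rw [mul_assoc]
  exact Nat.mul_le_mul_left _ (by nlinarith)

end Substitution

end LambdaSync

theorem theorem4p1 {A : Type*} [Finite A] [TopologicalSpace A] [DiscreteTopology A]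
    (ζ : LambdaSync.Substitution A) (hζ : ζ.IsPrimitive) :
    LambdaSync.IsLambdaSynchronizing ζ.subshift := by
  obtain ⟨C, hC⟩ := hζ.exists_complexity_le
  exact LambdaSync.isLambdaSynchronizing_of_complexity_le
    (fun _ hw => hζ.uniformly_recurrent hw) C hC
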